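/- Fix a first-order language without equality, function symbols and constants. Its symbols of arity zero are called propositional symbols, those of positive arity predicate symbols. Formulas are built from atoms and $\top,\bot$ with $\neg,\&,\vee,\supset,\forall,\exists$; there are infinitely many free variables. Let $\mathrm{LJ}$ and $\mathrm{LK}$ be Gentzen's intuitionistic and classical sequent calculi (with cut, and with the axioms $\vdash\top$ and $\bot\vdash$), and let $\mathrm{LJ}^+$ be $\mathrm{LJ}$ extended with the neutralization rule: from $N,\Gamma\vdash\Lambda$ and $\neg N,\Gamma\vdash\Lambda$ infer $\Gamma\vdash\Lambda$, where $N$ is any formula that contains no predicate symbols. A formula $F$ is derivable if the sequent $\vdash F$ is. The formula itself is a positive subformula occurrence of itself; $\&,\vee,\forall,\exists$ and the right side of $\supset$ preserve the sign of an occurrence, while $\neg$ and the left side of $\supset$ reverse it. A formula is unipolar if, for every propositional symbol, its occurrences in the formula are all positive or all negative. Theorem. (1) A unipolar formula is derivable in $\mathrm{LJ}^+$ if and only if it is derivable in $\mathrm{LJ}$. (2) If $A\vee B$ is unipolar and derivable in $\mathrm{LJ}^+$, then $A$ or $B$ is derivable in $\mathrm{LJ}^+$. (3) If $\exists x A(x)$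 is unipolar and derivable in $\mathrm{LJ}^+$, then $A(a)$ is derivable in $\mathrm{LJ}^+$ for some variable $a$. (4) For every unary predicate symbol $P$ and every propositional symbol $R$, the formula $(\exists x P(x)\vee\neg\exists x P(x))\vee R$ is derivable in $\mathrm{LK}$ but not in $\mathrm{LJ}^+$. (5) If the language has at least one predicate symbol, then some formula is derivable in $\mathrm{LK}$ but not in $\mathrm{LJ}^+$. -/

import Mathlib

universe u v

namespace DecAtoms

/-- Variables available under `n` quantifiers. As in Gentzen's calculi, free variables
(`Sum.inl a`, `a : ℕ`) and bound variables (`Sum.inr i`, `i : Fin n`, where `i` is the variable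
bound by the `i`-th enclosing quantifier, counted from the outside) are kept apart. -/
abbrev Var (n : ℕ) : Type := ℕ ⊕ Fin n

/-- First-order formulas, without equality, over the relation symbols of `L`, possibly with `n`
bound variables that are not yet quantified. The formulas proper are those with `n = 0`.
Symbols of arity zero are the propositional symbols, symbols of positive arity are the predicate
symbols. -/
inductive Formula (L : FirstOrder.Language.{u, v}) : ℕ → Type v
  | top {n : ℕ} : Formula L n
  | bot {n : ℕ} : Formula L n
  | prop {n : ℕ} (R : L.Relations 0) : Formula L n
  | pred {n k : ℕ} (P : L.Relations (k + 1)) (t : Fin (k + 1) → Var n) : Formula L n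
  | neg {n : ℕ} (A : Formula L n) : Formula L n
  | and {n : ℕ} (A B : Formula L n) : Formula L n
  | or {n : ℕ} (A B : Formula L n) : Formula L n
  | imp {n : ℕ} (A B : Formula L n) : Formula L n
  | all {n : ℕ} (A : Formula L (n + 1)) : Formula L n
  | ex {n : ℕ} (A : Formula L (n + 1)) : Formula L n

variable {L : FirstOrder.Language.{u, v}}

/-- Replace the outermost bound variable by the free variable `a`; the other bound variables are
renumbered. -/
def Var.inst (a : ℕ) {n : ℕ} : Var (n + 1) → Var n
  | Sum.inl b => Sum.inl b
  | Sum.inr i => Fin.cases (Sum.inl a) Sum.inr i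

namespace Formula

/-- `A.inst a` is `A(a)`: the outermost bound variable of `A` (the one that `all A` and `ex A`
quantify when `A : Formula L 1`) is replaced by the free variable `a`. -/
def inst (a : ℕ) : {n : ℕ} → Formula L (n + 1) → Formula L n
  | _, top => top
  | _, bot => bot
  | _, prop R => prop R
  | _, pred P t => pred P (fun i => (t i).inst a)
  | _, neg A => neg (inst a A)
  | _, and A B => and (inst a A) (inst a B)
  | _, or A B => or (inst a A) (inst a B)
  | _, imp A B => imp (inst a A) (inst a B)
  | _, all A => all (inst a A)
  | _, ex A => ex (inst a A)

/-- The free variable `a` occurs in the formula. -/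
def HasVar (a : ℕ) : {n : ℕ} → Formula L n → Prop
  | _, top => False
  | _, bot => False
  | _, prop _ => False
  | _, pred _ t => ∃ i, t i = Sum.inl a
  | _, neg A => HasVar a A
  | _, and A B => HasVar a A ∨ HasVar a B
  | _, or A B => HasVar a A ∨ HasVar a B
  | _, imp A B => HasVar a A ∨ HasVar a B
  | _, all A => HasVar a A
  | _, ex A => HasVar a A

/-- A formula is propositional if it contains no symbols other than propositional ones. -/
def IsPropositional : {n : ℕ} → Formula L n → Prop
  | _, top => True
  | _, bot => True
  | _, prop _ => True
  | _, pred _ _ => False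
  | _, neg A => IsPropositional A
  | _, and A B => IsPropositional A ∧ IsPropositional B
  | _, or A B => IsPropositional A ∧ IsPropositional B
  | _, imp A B => IsPropositional A ∧ IsPropositional B
  | _, all A => IsPropositional A
  | _, ex A => IsPropositional A

/-- `Occurs R true A`: the propositional symbol `R` has a positive occurrence in `A`;
`Occurs R false A`: it has a negative occurrence in `A`. -/
def Occurs (R : L.Relations 0) : Bool → {n : ℕ} → Formula L n → Prop
  | _, _, top => False
  | _, _, bot => False
  | p, _, prop S => p = true ∧ S = R
  | _, _, pred _ _ => False
  | p, _, neg A => Occurs R (!p) A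
  | p, _, and A B => Occurs R p A ∨ Occurs R p B
  | p, _, or A B => Occurs R p A ∨ Occurs R p B
  | p, _, imp A B => Occurs R (!p) A ∨ Occurs R p B
  | p, _, all A => Occurs R p A
  | p, _, ex A => Occurs R p A

/-- The occurrences of every propositional symbol are all positive or all negative. -/
def IsUnipolar {n : ℕ} (A : Formula L n) : Prop :=
  ∀ R : L.Relations 0, ¬ A.Occurs R false ∨ ¬ A.Occurs R true

end Formula

open Formula

/-- Gentzen's intuitionistic sequent calculus (antecedents are lists of formulas, succedents hold
at most one formula), extended with the neutralization rule for the formulas in `𝒩`. -/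
inductive Deriv (𝒩 : Set (Formula L 0)) : List (Formula L 0) → Option (Formula L 0) → Prop
  | ax (A : Formula L 0) : Deriv 𝒩 [A] (some A)
  | topAx : Deriv 𝒩 [] (some top)
  | botAx : Deriv 𝒩 [bot] none
  | thinL {Γ Λ} (A : Formula L 0) : Deriv 𝒩 Γ Λ → Deriv 𝒩 (A :: Γ) Λ
  | thinR {Γ} (A : Formula L 0) : Deriv 𝒩 Γ none → Deriv 𝒩 Γ (some A)
  | contr {A Γ Λ} : Deriv 𝒩 (A :: A :: Γ) Λ → Deriv 𝒩 (A :: Γ) Λ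
  | exch {Δ A B Γ Λ} : Deriv 𝒩 (Δ ++ A :: B :: Γ) Λ → Deriv 𝒩 (Δ ++ B :: A :: Γ) Λ
  | cut {Γ Δ C Λ} : Deriv 𝒩 Γ (some C) → Deriv 𝒩 (C :: Δ) Λ → Deriv 𝒩 (Γ ++ Δ) Λ
  | andR {Γ A B} : Deriv 𝒩 Γ (some A) → Deriv 𝒩 Γ (some B) → Deriv 𝒩 Γ (some (and A B))
  | andL₁ {A B Γ Λ} : Deriv 𝒩 (A :: Γ) Λ → Deriv 𝒩 (and A B :: Γ) Λ
  | andL₂ {A B Γ Λ} : Deriv 𝒩 (B :: Γ) Λ → Deriv 𝒩 (and A B :: Γ) Λ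
  | orL {A B Γ Λ} : Deriv 𝒩 (A :: Γ) Λ → Deriv 𝒩 (B :: Γ) Λ → Deriv 𝒩 (or A B :: Γ) Λ
  | orR₁ {A B Γ} : Deriv 𝒩 Γ (some A) → Deriv 𝒩 Γ (some (or A B))
  | orR₂ {A B Γ} : Deriv 𝒩 Γ (some B) → Deriv 𝒩 Γ (some (or A B))
  | negR {A Γ} : Deriv 𝒩 (A :: Γ) none → Deriv 𝒩 Γ (some (neg A))
  | negL {A Γ} : Deriv 𝒩 Γ (some A) → Deriv 𝒩 (neg A :: Γ) none
  | impR {A B Γ} : Deriv 𝒩 (A :: Γ) (some B) → Deriv 𝒩 Γ (some (imp A B))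
  | impL {A B Γ Δ Λ} : Deriv 𝒩 Γ (some A) → Deriv 𝒩 (B :: Δ) Λ →
      Deriv 𝒩 (imp A B :: (Γ ++ Δ)) Λ
  | allR {F : Formula L 1} {Γ} (a : ℕ) (hΓ : ∀ G ∈ Γ, ¬ G.HasVar a) (hF : ¬ F.HasVar a) :
      Deriv 𝒩 Γ (some (F.inst a)) → Deriv 𝒩 Γ (some (all F))
  | allL {F : Formula L 1} {Γ Λ} (a : ℕ) : Deriv 𝒩 (F.inst a :: Γ) Λ → Deriv 𝒩 (all F :: Γ) Λ
  | exR {F : Formula L 1} {Γ} (a : ℕ) : Deriv 𝒩 Γ (some (F.inst a)) → Deriv 𝒩 Γ (some (ex F))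
  | exL {F : Formula L 1} {Γ Λ} (a : ℕ) (hΓ : ∀ G ∈ Γ, ¬ G.HasVar a)
      (hΛ : ∀ G ∈ Λ, ¬ G.HasVar a) (hF : ¬ F.HasVar a) :
      Deriv 𝒩 (F.inst a :: Γ) Λ → Deriv 𝒩 (ex F :: Γ) Λ
  | neutral {N Γ Λ} (hN : N ∈ 𝒩) : Deriv 𝒩 (N :: Γ) Λ → Deriv 𝒩 (neg N :: Γ) Λ → Deriv 𝒩 Γ Λ

/-- Derivability of a formula in LJ (no neutralization rule). -/
def LJ (A : Formula L 0) : Prop := Deriv ∅ [] (some A)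

/-- Derivability of a formula in LJ⁺: LJ with neutralization of propositional formulas. -/
def LJPlus (A : Formula L 0) : Prop := Deriv {N | N.IsPropositional} [] (some A)

/-- Gentzen's classical sequent calculus LK; antecedents and succedents are lists of formulas. -/
inductive DerivLK : List (Formula L 0) → List (Formula L 0) → Prop
  | ax (A : Formula L 0) : DerivLK [A] [A]
  | topAx : DerivLK [] [top]
  | botAx : DerivLK [bot] []
  | thinL {Γ Θ} (A : Formula L 0) : DerivLK Γ Θ → DerivLK (A :: Γ) Θ
  | thinR {Γ Θ} (A : Formula L 0) : DerivLK Γ Θ → DerivLK Γ (Θ ++ [A])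
  | contrL {A Γ Θ} : DerivLK (A :: A :: Γ) Θ → DerivLK (A :: Γ) Θ
  | contrR {A Γ Θ} : DerivLK Γ (Θ ++ [A, A]) → DerivLK Γ (Θ ++ [A])
  | exchL {Δ A B Γ Θ} : DerivLK (Δ ++ A :: B :: Γ) Θ → DerivLK (Δ ++ B :: A :: Γ) Θ
  | exchR {Γ Θ A B Λ} : DerivLK Γ (Θ ++ A :: B :: Λ) → DerivLK Γ (Θ ++ B :: A :: Λ)
  | cut {Γ Δ C Θ Λ} : DerivLK Γ (Θ ++ [C]) → DerivLK (C :: Δ) Λ → DerivLK (Γ ++ Δ) (Θ ++ Λ)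
  | andR {Γ Θ A B} : DerivLK Γ (Θ ++ [A]) → DerivLK Γ (Θ ++ [B]) → DerivLK Γ (Θ ++ [and A B])
  | andL₁ {A B Γ Θ} : DerivLK (A :: Γ) Θ → DerivLK (and A B :: Γ) Θ
  | andL₂ {A B Γ Θ} : DerivLK (B :: Γ) Θ → DerivLK (and A B :: Γ) Θ
  | orL {A B Γ Θ} : DerivLK (A :: Γ) Θ → DerivLK (B :: Γ) Θ → DerivLK (or A B :: Γ) Θ
  | orR₁ {A B Γ Θ} : DerivLK Γ (Θ ++ [A]) → DerivLK Γ (Θ ++ [or A B])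
  | orR₂ {A B Γ Θ} : DerivLK Γ (Θ ++ [B]) → DerivLK Γ (Θ ++ [or A B])
  | negR {A Γ Θ} : DerivLK (A :: Γ) Θ → DerivLK Γ (Θ ++ [neg A])
  | negL {A Γ Θ} : DerivLK Γ (Θ ++ [A]) → DerivLK (neg A :: Γ) Θ
  | impR {A B Γ Θ} : DerivLK (A :: Γ) (Θ ++ [B]) → DerivLK Γ (Θ ++ [imp A B])
  | impL {A B Γ Δ Θ Λ} : DerivLK Γ (Θ ++ [A]) → DerivLK (B :: Δ) Λ →
      DerivLK (imp A B :: (Γ ++ Δ)) (Θ ++ Λ)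
  | allR {F : Formula L 1} {Γ Θ} (a : ℕ) (hΓ : ∀ G ∈ Γ, ¬ G.HasVar a)
      (hΘ : ∀ G ∈ Θ, ¬ G.HasVar a) (hF : ¬ F.HasVar a) :
      DerivLK Γ (Θ ++ [F.inst a]) → DerivLK Γ (Θ ++ [all F])
  | allL {F : Formula L 1} {Γ Θ} (a : ℕ) : DerivLK (F.inst a :: Γ) Θ → DerivLK (all F :: Γ) Θ
  | exR {F : Formula L 1} {Γ Θ} (a : ℕ) :
      DerivLK Γ (Θ ++ [F.inst a]) → DerivLK Γ (Θ ++ [ex F])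
  | exL {F : Formula L 1} {Γ Θ} (a : ℕ) (hΓ : ∀ G ∈ Γ, ¬ G.HasVar a)
      (hΘ : ∀ G ∈ Θ, ¬ G.HasVar a) (hF : ¬ F.HasVar a) :
      DerivLK (F.inst a :: Γ) Θ → DerivLK (ex F :: Γ) Θ

/-- Derivability of a formula in LK. -/
def LK (A : Formula L 0) : Prop := DerivLK [] [A]

/-- The formula `∃x P(x)` for a unary predicate symbol `P`. -/
def exPred (P : L.Relations 1) : Formula L 0 := ex (pred P (fun _ => Sum.inr 0))

/-- The formula `(∃x P(x) ∨ ¬∃x P(x)) ∨ R`. -/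
def lemExOr (P : L.Relations 1) (R : L.Relations 0) : Formula L 0 :=
  or (or (exPred P) (neg (exPred P))) (prop R)

end DecAtoms

/-! Neutralization amounts to excluded middle for formulas without predicate symbols. If each
propositional symbol is replaced by `⊤` or `⊥`, such formulas become decidable in LJ
(`ground_decided`), so every neutralization becomes a cut and an LJ⁺ derivation of `F` yields an LJ
derivation of the ground version of `F` (`Deriv.ground`). For unipolar `F`, send the positive
symbols to `⊥` and the negative ones to `⊤`: this only strengthens `F`, so the ground version
implies `F` in LJ (`deriv_ground_of_polarity`), and a cut gives `F`.

The disjunction and existence properties thereby reduce to those of LJ. These come from the slash,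
which holds of every formula derivable in LJ and whose clauses for `∨` and `∃` single out a disjunct
or an instance; no cut elimination is needed.

For non-derivability, the disjunction property splits a unipolar instance of excluded middle into
its disjuncts, and one-element classical structures, for which LJ⁺ is sound, refute each of them. -/

namespace DecAtoms

open Formula

variable {L : FirstOrder.Language.{u, v}}

/-! ### Syntax: induction principles, fresh variables, renaming, grounding, truth values -/

namespace Formula

/-- The number of connectives and quantifiers of a formula. -/
def size : {n : ℕ} → Formula L n → ℕ
  | _, top => 0
  | _, bot => 0
  | _, prop _ => 0
  | _, pred _ _ => 0
  | _, neg A => size A + 1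
  | _, and A B => size A + size B + 1
  | _, or A B => size A + size B + 1
  | _, imp A B => size A + size B + 1
  | _, all A => size A + 1
  | _, ex A => size A + 1

/-- Induction on formulas in which at least one bound variable is available. -/
theorem succ_induction {C : ∀ n, Formula L (n + 1) → Prop} (top : ∀ n, C n top)
    (bot : ∀ n, C n bot) (prop : ∀ n R, C n (prop R))
    (pred : ∀ n {k} (P : L.Relations (k + 1)) t, C n (pred P t))
    (neg : ∀ n A, C n A → C n (neg A)) (and : ∀ n A B, C n A → C n B → C n (and A B))
    (or : ∀ n A B, C n A → C n B → C n (or A B)) (imp : ∀ n A B, C n A → C n B → C n (imp A B))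
    (all : ∀ n A, C (n + 1) A → C n (all A)) (ex : ∀ n A, C (n + 1) A → C n (ex A))
    {n : ℕ} (A : Formula L (n + 1)) : C n A := by
  -- The index `n + 1` is replaced by a variable `m` with an equation, so that ordinary induction
  -- applies.
  suffices h : ∀ m (B : Formula L m) n (hm : m = n + 1), C n (hm ▸ B) from h _ A n rfl
  intro m B
  induction B with
  | top => rintro n rfl; exact top n
  | bot => rintro n rfl; exact bot n
  | prop R => rintro n rfl; exact prop n R
  | pred P t => rintro n rfl; exact pred n P t
  | neg A ih => rintro n rfl; exact neg n A (ih n rfl)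
  | and A B ihA ihB => rintro n rfl; exact and n A B (ihA n rfl) (ihB n rfl)
  | or A B ihA ihB => rintro n rfl; exact or n A B (ihA n rfl) (ihB n rfl)
  | imp A B ihA ihB => rintro n rfl; exact imp n A B (ihA n rfl) (ihB n rfl)
  | all A ih => rintro n rfl; exact all n A (ih _ rfl)
  | ex A ih => rintro n rfl; exact ex n A (ih _ rfl)

@[simp]
theorem size_inst (a : ℕ) {n : ℕ} (A : Formula L (n + 1)) : size (inst a A) = size A := by
  induction A using succ_induction <;> simp_all [inst, size]

/-- Induction on formulas without dangling bound variables; the immediate subformulas of a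
quantified formula are its instances. -/
theorem inst_induction {C : Formula L 0 → Prop} (top : C top) (bot : C bot)
    (prop : ∀ R, C (prop R)) (pred : ∀ {k} (P : L.Relations (k + 1)) t, C (pred P t))
    (neg : ∀ A, C A → C (neg A)) (and : ∀ A B, C A → C B → C (and A B))
    (or : ∀ A B, C A → C B → C (or A B)) (imp : ∀ A B, C A → C B → C (imp A B))
    (all : ∀ F : Formula L 1, (∀ a, C (F.inst a)) → C (all F))
    (ex : ∀ F : Formula L 1, (∀ a, C (F.inst a)) → C (ex F)) (A : Formula L 0) : C A := by
  induction h : A.size using Nat.strong_induction_on generalizing A with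
  | _ k ih =>
    subst h
    cases A with
    | top => exact top
    | bot => exact bot
    | prop R => exact prop R
    | pred P t => exact pred P t
    | neg A => exact neg A (ih _ (by simp [size]) A rfl)
    | and A B =>
      exact and A B (ih _ (by simp only [size]; omega) A rfl)
        (ih _ (by simp only [size]; omega) B rfl)
    | or A B =>
      exact or A B (ih _ (by simp only [size]; omega) A rfl)
        (ih _ (by simp only [size]; omega) B rfl)
    | imp A B =>
      exact imp A B (ih _ (by simp only [size]; omega) A rfl)
        (ih _ (by simp only [size]; omega) B rfl)
    | all F => exact all F fun a => ih _ (by simp [size]) (F.inst a) rfl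
    | ex F => exact ex F fun a => ih _ (by simp [size]) (F.inst a) rfl

theorem isPropositional_inst (a : ℕ) {n : ℕ} (A : Formula L (n + 1)) :
    IsPropositional (inst a A) ↔ IsPropositional A := by
  induction A using succ_induction <;> simp_all [inst, IsPropositional]

theorem occurs_inst (R : L.Relations 0) (a : ℕ) {n : ℕ} (A : Formula L (n + 1)) (p : Bool) :
    Occurs R p (inst a A) ↔ Occurs R p A := by
  induction A using succ_induction generalizing p with
  | top | bot | prop | pred => simp only [inst, Occurs]
  | neg n A ih | all n A ih | ex n A ih => simp only [inst, Occurs, ih]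
  | and n A B ihA ihB | or n A B ihA ihB | imp n A B ihA ihB =>
    simp only [inst, Occurs, ihA, ihB]

theorem exists_fresh {n : ℕ} (A : Formula L n) : ∃ m, ∀ a, m ≤ a → ¬ A.HasVar a := by
  induction A with
  | top | bot | prop => exact ⟨0, fun a _ h => h⟩
  | pred P t =>
    -- Each free variable `b` among the arguments contributes `b + 1`, hence lies strictly below the
    -- sum.
    refine ⟨∑ i, Sum.elim (fun b => b + 1) (fun _ => 0) (t i), ?_⟩
    rintro a ha ⟨i, hi⟩
    have := Finset.single_le_sum (f := fun i => Sum.elim (fun b => b + 1) (fun _ => 0) (t i))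
      (fun _ _ => Nat.zero_le _) (Finset.mem_univ i)
    simp only [hi, Sum.elim_inl] at this
    omega
  | neg A ih | all A ih | ex A ih => exact ih
  | and A B ihA ihB | or A B ihA ihB | imp A B ihA ihB =>
    obtain ⟨m, hm⟩ := ihA
    obtain ⟨k, hk⟩ := ihB
    refine ⟨max m k, fun a ha h => h.elim (hm a ?_) (hk a ?_)⟩ <;> omega

theorem exists_fresh_list (Γ : List (Formula L 0)) : ∃ m, ∀ a, m ≤ a → ∀ G ∈ Γ, ¬ G.HasVar a := by
  induction Γ with
  | nil => exact ⟨0, by simp⟩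
  | cons A Γ ih =>
    obtain ⟨m, hm⟩ := ih
    obtain ⟨k, hk⟩ := A.exists_fresh
    refine ⟨max m k, fun a ha => List.forall_mem_cons.2 ⟨hk a ?_, hm a ?_⟩⟩ <;> omega

/-- Rename the free variables of a formula. -/
def rename (e : ℕ → ℕ) : {n : ℕ} → Formula L n → Formula L n
  | _, top => top
  | _, bot => bot
  | _, prop R => prop R
  | _, pred P t => pred P (fun i => (t i).map e id)
  | _, neg A => neg (rename e A)
  | _, and A B => and (rename e A) (rename e B)
  | _, or A B => or (rename e A) (rename e B)
  | _, imp A B => imp (rename e A) (rename e B)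
  | _, all A => all (rename e A)
  | _, ex A => ex (rename e A)

@[simp]
theorem rename_id {n : ℕ} (A : Formula L n) : A.rename id = A := by
  induction A <;> simp_all [rename]

theorem rename_congr {e f : ℕ → ℕ} {n : ℕ} (A : Formula L n)
    (h : ∀ a, A.HasVar a → e a = f a) : A.rename e = A.rename f := by
  induction A with
  | top | bot | prop => rfl
  | pred P t =>
    simp only [rename, pred.injEq, heq_eq_eq, true_and]
    funext i
    cases hi : t i with
    | inl b => simp [h b ⟨i, hi⟩]
    | inr b => rfl
  | neg A ih | all A ih | ex A ih => simp only [rename, ih h]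
  | and A B ihA ihB | or A B ihA ihB | imp A B ihA ihB =>
    simp only [rename, ihA fun a ha => h a (Or.inl ha), ihB fun a ha => h a (Or.inr ha)]

theorem rename_update {e : ℕ → ℕ} {a : ℕ} (b : ℕ) {n : ℕ} {A : Formula L n}
    (h : ¬ A.HasVar a) : A.rename (Function.update e a b) = A.rename e :=
  rename_congr A fun c hc => Function.update_of_ne (by rintro rfl; exact h hc) _ _

theorem rename_inst (e : ℕ → ℕ) (a : ℕ) {n : ℕ} (A : Formula L (n + 1)) :
    rename e (inst a A) = inst (e a) (rename e A) := by
  induction A using succ_induction with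
  | pred n P t =>
    simp only [inst, rename, pred.injEq, heq_eq_eq, true_and]
    funext i
    rcases t i with b | j
    · rfl
    · cases j using Fin.cases <;> rfl
  | _ => simp_all [inst, rename]

/-- This lets an eigenvariable `a` be redirected to any `b`: a fresh one in `Deriv.rename`, an
arbitrary one in `Deriv.slash`. -/
theorem rename_update_inst {e : ℕ → ℕ} {a : ℕ} (b : ℕ) {F : Formula L 1} (h : ¬ F.HasVar a) :
    (F.inst a).rename (Function.update e a b) = (F.rename e).inst b := by
  rw [rename_inst, Function.update_self, rename_update b h]

/-- Replace each propositional symbol by `⊤` or `⊥`, as given by `σ`. -/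
def ground (σ : L.Relations 0 → Bool) : {n : ℕ} → Formula L n → Formula L n
  | _, top => top
  | _, bot => bot
  | _, prop R => if σ R then top else bot
  | _, pred P t => pred P t
  | _, neg A => neg (ground σ A)
  | _, and A B => and (ground σ A) (ground σ B)
  | _, or A B => or (ground σ A) (ground σ B)
  | _, imp A B => imp (ground σ A) (ground σ B)
  | _, all A => all (ground σ A)
  | _, ex A => ex (ground σ A)

theorem ground_inst (σ : L.Relations 0 → Bool) (a : ℕ) {n : ℕ} (A : Formula L (n + 1)) :
    ground σ (inst a A) = inst a (ground σ A) := by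
  induction A using succ_induction with
  | prop n R => cases hR : σ R <;> simp [inst, ground, hR]
  | _ => simp_all [inst, ground]

@[simp]
theorem hasVar_ground (σ : L.Relations 0 → Bool) (a : ℕ) {n : ℕ} (A : Formula L n) :
    (A.ground σ).HasVar a ↔ A.HasVar a := by
  induction A with
  | prop R => cases hR : σ R <;> simp [HasVar, ground, hR]
  | _ => simp_all [HasVar, ground]

/-- The truth value of a formula in a structure with one element. -/
def Holds (v : ∀ k, L.Relations k → Prop) : {n : ℕ} → Formula L n → Prop
  | _, top => True
  | _, bot => False
  | _, prop R => v 0 R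
  | _, pred P _ => v _ P
  | _, neg A => ¬ Holds v A
  | _, and A B => Holds v A ∧ Holds v B
  | _, or A B => Holds v A ∨ Holds v B
  | _, imp A B => Holds v A → Holds v B
  | _, all A => Holds v A
  | _, ex A => Holds v A

theorem holds_inst (v : ∀ k, L.Relations k → Prop) (a : ℕ) {n : ℕ} (A : Formula L (n + 1)) :
    Holds v (inst a A) ↔ Holds v A := by
  induction A using succ_induction <;> simp_all [inst, Holds]

end Formula

/-! ### Monotonicity and classical soundness -/

theorem Deriv.mono {𝒩 𝒩' : Set (Formula L 0)} (h : 𝒩 ⊆ 𝒩') {Γ : List (Formula L 0)}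
    {Λ : Option (Formula L 0)} (d : Deriv 𝒩 Γ Λ) : Deriv 𝒩' Γ Λ := by
  induction d with
  | ax A => exact .ax A
  | topAx => exact .topAx
  | botAx => exact .botAx
  | thinL A _ ih => exact .thinL A ih
  | thinR A _ ih => exact .thinR A ih
  | contr _ ih => exact .contr ih
  | exch _ ih => exact .exch ih
  | cut _ _ ih₁ ih₂ => exact .cut ih₁ ih₂
  | andR _ _ ih₁ ih₂ => exact .andR ih₁ ih₂
  | andL₁ _ ih => exact .andL₁ ih
  | andL₂ _ ih => exact .andL₂ ih
  | orL _ _ ih₁ ih₂ => exact .orL ih₁ ih₂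
  | orR₁ _ ih => exact .orR₁ ih
  | orR₂ _ ih => exact .orR₂ ih
  | negR _ ih => exact .negR ih
  | negL _ ih => exact .negL ih
  | impR _ ih => exact .impR ih
  | impL _ _ ih₁ ih₂ => exact .impL ih₁ ih₂
  | allR a hΓ hF _ ih => exact .allR a hΓ hF ih
  | allL a _ ih => exact .allL a ih
  | exR a _ ih => exact .exR a ih
  | exL a hΓ hΛ hF _ ih => exact .exL a hΓ hΛ hF ih
  | neutral hN _ _ ih₁ ih₂ => exact .neutral (h hN) ih₁ ih₂

theorem LJ.ljPlus {A : Formula L 0} (h : LJ A) : LJPlus A :=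
  Deriv.mono (Set.empty_subset _) h

/-- Soundness of `Deriv` for classical structures with one element. -/
theorem Deriv.holds {𝒩 : Set (Formula L 0)} (v : ∀ k, L.Relations k → Prop)
    {Γ : List (Formula L 0)} {Λ : Option (Formula L 0)} (d : Deriv 𝒩 Γ Λ)
    (hΓ : ∀ G ∈ Γ, G.Holds v) : ∃ G ∈ Λ, G.Holds v := by
  induction d with
  | neutral hN _ _ ih₁ ih₂ =>
    rename_i N _ _ _ _
    by_cases hv : N.Holds v
    · exact ih₁ (List.forall_mem_cons.2 ⟨hv, hΓ⟩)
    · exact ih₂ (List.forall_mem_cons.2 ⟨hv, hΓ⟩)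
  | _ => simp_all [Holds, holds_inst, or_imp, forall_and] <;> grind

/-! ### Conservativity of LJ⁺ over LJ for unipolar formulas -/

/-- A formula without predicate symbols is decided by `LJ` once its propositional symbols are
replaced by truth values. -/
theorem ground_decided (σ : L.Relations 0 → Bool) (N : Formula L 0) (hN : N.IsPropositional) :
    LJ (N.ground σ) ∨ Deriv ∅ [N.ground σ] none := by
  induction N using inst_induction with
  | top => exact .inl .topAx
  | bot => exact .inr .botAx
  | prop R =>
    cases hR : σ R
    · right; simpa [ground, hR] using Deriv.botAx
    · left; simpa [ground, hR, LJ] using Deriv.topAx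
  | pred P t => exact hN.elim
  | neg A ih =>
    rcases ih hN with h | h
    · exact .inr (.negL h)
    · exact .inl (.negR h)
  | and A B ihA ihB =>
    rcases ihA hN.1 with hA | hA
    · rcases ihB hN.2 with hB | hB
      · exact .inl (.andR hA hB)
      · exact .inr (.andL₂ hB)
    · exact .inr (.andL₁ hA)
  | or A B ihA ihB =>
    rcases ihA hN.1 with hA | hA
    · exact .inl (.orR₁ hA)
    · rcases ihB hN.2 with hB | hB
      · exact .inl (.orR₂ hB)
      · exact .inr (.orL hA hB)
  | imp A B ihA ihB =>
    rcases ihA hN.1 with hA | hA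
    · rcases ihB hN.2 with hB | hB
      · exact .inl (.impR (.thinL _ hB))
      · exact .inr (.impL (Γ := []) hA hB)
    · exact .inl (.impR (.thinR _ hA))
  | all F ih =>
    -- A single instance at a fresh variable suffices: if derivable it generalizes, and if refutable
    -- it refutes `∀`.
    obtain ⟨m, hm⟩ := F.exists_fresh
    have := ih m ((isPropositional_inst m F).2 hN)
    rw [ground_inst] at this
    exact this.imp (.allR m (by simp) (by simpa using hm m le_rfl)) (.allL m)
  | ex F ih =>
    obtain ⟨m, hm⟩ := F.exists_fresh
    have := ih m ((isPropositional_inst m F).2 hN)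
    rw [ground_inst] at this
    exact this.imp (.exR m) (.exL m (by simp) (by simp) (by simpa using hm m le_rfl))

/-- Replacing the propositional symbols by truth values turns derivations of `LJ⁺` into
derivations of `LJ`. -/
theorem Deriv.ground (σ : L.Relations 0 → Bool) {Γ : List (Formula L 0)}
    {Λ : Option (Formula L 0)} (d : Deriv {N | N.IsPropositional} Γ Λ) :
    Deriv ∅ (Γ.map (Formula.ground σ)) (Λ.map (Formula.ground σ)) := by
  induction d with
  | ax A => exact .ax _
  | topAx => exact .topAx
  | botAx => exact .botAx
  | thinL A _ ih => exact .thinL _ ih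
  | thinR A _ ih => exact .thinR _ ih
  | contr _ ih => exact .contr ih
  | exch _ ih =>
    simp only [List.map_append, List.map_cons] at ih ⊢
    exact .exch ih
  | cut _ _ ih₁ ih₂ =>
    rw [List.map_append]
    exact .cut ih₁ ih₂
  | andR _ _ ih₁ ih₂ => exact .andR ih₁ ih₂
  | andL₁ _ ih => exact .andL₁ ih
  | andL₂ _ ih => exact .andL₂ ih
  | orL _ _ ih₁ ih₂ => exact .orL ih₁ ih₂
  | orR₁ _ ih => exact .orR₁ ih
  | orR₂ _ ih => exact .orR₂ ih
  | negR _ ih => exact .negR ih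
  | negL _ ih => exact .negL ih
  | impR _ ih => exact .impR ih
  | impL _ _ ih₁ ih₂ =>
    rw [List.map_cons, List.map_append]
    exact .impL ih₁ ih₂
  | allR a hΓ hF _ ih =>
    rw [Option.map_some, ground_inst] at ih
    exact .allR a (by simpa using hΓ) (by simpa using hF) ih
  | allL a _ ih =>
    rw [List.map_cons, ground_inst] at ih
    exact .allL a ih
  | exR a _ ih =>
    rw [Option.map_some, ground_inst] at ih
    exact .exR a ih
  | exL a hΓ hΛ hF _ ih =>
    rw [List.map_cons, ground_inst] at ih
    exact .exL a (by simpa using hΓ) (by simpa using hΛ) (by simpa using hF) ih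
  | neutral hN _ _ ih₁ ih₂ =>
    -- The decision for the ground version of `N` selects which premise to keep, and a cut removes
    -- `N` or `¬N` from it.
    rcases ground_decided σ _ hN with h | h
    · exact .cut (Γ := []) h ih₁
    · exact .cut (Γ := []) (.negR h) ih₂

/-- If `σ` makes the positive symbols of `A` false and the negative ones true, then `A` follows
from its ground version; dually for the opposite choice. -/
theorem deriv_ground_of_polarity (σ : L.Relations 0 → Bool) (A : Formula L 0) :
    ((∀ R q, A.Occurs R q → σ R = !q) → Deriv ∅ [A.ground σ] (some A)) ∧
      ((∀ R q, A.Occurs R q → σ R = q) → Deriv ∅ [A] (some (A.ground σ))) := by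
  induction A using inst_induction with
  | top | bot | pred => exact ⟨fun _ => .ax _, fun _ => .ax _⟩
  | prop R =>
    -- The symbol occurs positively in itself, so its ground version is `⊥` in the first half and
    -- `⊤` in the second.
    constructor <;> intro h <;> have hR := h R true ⟨rfl, rfl⟩
    · simpa [ground, hR] using .thinR _ .botAx
    · simpa [ground, hR] using .thinL _ .topAx
  | neg A ih =>
    constructor <;> intro h
    -- Negation flips polarities, so each half uses the opposite half of the induction hypothesis;
    -- likewise on the left of `⊃`.
    · exact .negR (.exch (Δ := []) (.negL (ih.2 fun R q hq => by
        simpa using h R (!q) (by simpa [Occurs] using hq))))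
    · exact .negR (.exch (Δ := []) (.negL (ih.1 fun R q hq => by
        simpa using h R (!q) (by simpa [Occurs] using hq))))
  | and A B ihA ihB =>
    constructor <;> intro h
    · exact .andR (.andL₁ (ihA.1 fun R q hq => h R q (.inl hq)))
        (.andL₂ (ihB.1 fun R q hq => h R q (.inr hq)))
    · exact .andR (.andL₁ (ihA.2 fun R q hq => h R q (.inl hq)))
        (.andL₂ (ihB.2 fun R q hq => h R q (.inr hq)))
  | or A B ihA ihB =>
    constructor <;> intro h
    · exact .orL (.orR₁ (ihA.1 fun R q hq => h R q (.inl hq)))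
        (.orR₂ (ihB.1 fun R q hq => h R q (.inr hq)))
    · exact .orL (.orR₁ (ihA.2 fun R q hq => h R q (.inl hq)))
        (.orR₂ (ihB.2 fun R q hq => h R q (.inr hq)))
  | imp A B ihA ihB =>
    constructor <;> intro h
    · exact .impR (.exch (Δ := []) (.impL (Γ := [A]) (Δ := []) (ihA.2 fun R q hq => by
        simpa using h R (!q) (.inl (by simpa using hq))) (ihB.1 fun R q hq => h R q (.inr hq))))
    · exact .impR (.exch (Δ := []) (.impL (Γ := [A.ground σ]) (Δ := []) (ihA.1 fun R q hq => by
        simpa using h R (!q) (.inl (by simpa using hq))) (ihB.2 fun R q hq => h R q (.inr hq))))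
  | all F ih =>
    obtain ⟨m, hm⟩ := F.exists_fresh
    have hF := hm m le_rfl
    have ihm := ih m
    rw [ground_inst] at ihm
    constructor <;> intro h
    · exact .allR m (by simpa [HasVar, ground] using hF) hF
        (.allL m (ihm.1 fun R q hq => h R q ((occurs_inst R m F q).1 hq)))
    · exact .allR m (by simpa [HasVar] using hF) (by simpa using hF)
        (.allL m (ihm.2 fun R q hq => h R q ((occurs_inst R m F q).1 hq)))
  | ex F ih =>
    obtain ⟨m, hm⟩ := F.exists_fresh
    have hF := hm m le_rfl
    have ihm := ih m
    rw [ground_inst] at ihm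
    constructor <;> intro h
    · exact .exL m (by simp) (by simpa [HasVar] using hF) (by simpa using hF)
        (.exR m (ihm.1 fun R q hq => h R q ((occurs_inst R m F q).1 hq)))
    · exact .exL m (by simp) (by simpa [HasVar, ground] using hF) hF
        (.exR m (ihm.2 fun R q hq => h R q ((occurs_inst R m F q).1 hq)))

/-- `LJ⁺` is conservative over `LJ` for unipolar formulas. -/
theorem LJPlus.lj {F : Formula L 0} (hF : F.IsUnipolar) (h : LJPlus F) : LJ F := by
  classical
  -- Exactly the symbols with a negative occurrence become true; by unipolarity those occurring
  -- positively become false.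
  let σ : L.Relations 0 → Bool := fun R => decide (F.Occurs R false)
  refine Deriv.cut (Γ := []) (Deriv.ground σ h) ((deriv_ground_of_polarity σ F).1 fun R q hq => ?_)
  cases q with
  | false => simpa [σ] using hq
  | true => simpa [σ] using (hF R).resolve_right (not_not_intro hq)

/-! ### Renaming and the slash for LJ -/

/-- Derivability in `LJ` is closed under renaming of free variables. -/
theorem Deriv.rename {Γ : List (Formula L 0)} {Λ : Option (Formula L 0)} (d : Deriv ∅ Γ Λ)
    (e : ℕ → ℕ) : Deriv ∅ (Γ.map (Formula.rename e)) (Λ.map (Formula.rename e)) := by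
  induction d generalizing e with
  | ax A => exact .ax _
  | topAx => exact .topAx
  | botAx => exact .botAx
  | thinL A _ ih => exact .thinL _ (ih e)
  | thinR A _ ih => exact .thinR _ (ih e)
  | contr _ ih => exact .contr (ih e)
  | exch _ ih =>
    simp only [List.map_append, List.map_cons] at ih ⊢
    exact .exch (ih e)
  | cut _ _ ih₁ ih₂ =>
    rw [List.map_append]
    exact .cut (ih₁ e) (ih₂ e)
  | andR _ _ ih₁ ih₂ => exact .andR (ih₁ e) (ih₂ e)
  | andL₁ _ ih => exact .andL₁ (ih e)
  | andL₂ _ ih => exact .andL₂ (ih e)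
  | orL _ _ ih₁ ih₂ => exact .orL (ih₁ e) (ih₂ e)
  | orR₁ _ ih => exact .orR₁ (ih e)
  | orR₂ _ ih => exact .orR₂ (ih e)
  | negR _ ih => exact .negR (ih e)
  | negL _ ih => exact .negL (ih e)
  | impR _ ih => exact .impR (ih e)
  | impL _ _ ih₁ ih₂ =>
    rw [List.map_cons, List.map_append]
    exact .impL (ih₁ e) (ih₂ e)
  | @allR F Γ a hΓ hF _ ih =>
    -- `e` may map `a` onto a variable of the renamed sequent, so the eigenvariable is sent to a
    -- fresh `m` instead.
    obtain ⟨m, hm⟩ := exists_fresh_list (Formula.all (F.rename e) :: Γ.map (Formula.rename e))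
    have hb := List.forall_mem_cons.1 (hm m le_rfl)
    have d := ih (Function.update e a m)
    rw [List.map_congr_left fun G hG => rename_update m (hΓ G hG), Option.map_some,
      rename_update_inst m hF] at d
    exact .allR m hb.2 hb.1 d
  | @allL F Γ Λ a _ ih => exact .allL (e a) (rename_inst e a F ▸ ih e)
  | @exR F Γ a _ ih => exact .exR (e a) (rename_inst e a F ▸ ih e)
  | @exL F Γ Λ a hΓ hΛ hF _ ih =>
    obtain ⟨m, hm⟩ := exists_fresh_list (Formula.ex (F.rename e) ::
      ((Λ.map (Formula.rename e)).toList ++ Γ.map (Formula.rename e)))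
    have hb := List.forall_mem_cons.1 (hm m le_rfl)
    have hb' := List.forall_mem_append.1 hb.2
    have d := ih (Function.update e a m)
    rw [List.map_cons, List.map_congr_left fun G hG => rename_update m (hΓ G hG),
      rename_update_inst m hF, Option.map_congr fun G hG => rename_update m (hΛ G hG)] at d
    exact .exL m hb'.2 (fun G hG => hb'.1 G (by simpa using hG)) hb.1 d
  | neutral hN => exact hN.elim

theorem Deriv.cut_all {Γ : List (Formula L 0)} {Λ : Option (Formula L 0)} (d : Deriv ∅ Γ Λ)
    (h : ∀ G ∈ Γ, LJ G) : Deriv ∅ [] Λ := by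
  induction Γ with
  | nil => exact d
  | cons G Γ ih =>
    have h := List.forall_mem_cons.1 h
    exact ih (.cut (Γ := []) h.1 d) h.2

/-- The slash of Kleene and Aczel, for `LJ` without assumptions. -/
def Slash : Formula L 0 → Prop
  | .top => True
  | .bot => False
  | .prop R => LJ (.prop R)
  | .pred P t => LJ (.pred P t)
  | .neg A => LJ (.neg A) ∧ ¬ Slash A
  | .and A B => Slash A ∧ Slash B
  | .or A B => Slash A ∨ Slash B
  | .imp A B => LJ (.imp A B) ∧ (Slash A → Slash B)
  | .all F => LJ (.all F) ∧ ∀ a, Slash (F.inst a)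
  | .ex F => ∃ a, Slash (F.inst a)
termination_by A => A.size
decreasing_by all_goals simp only [size, size_inst]; omega

/-- The clauses for atoms, `¬`, `⊃` and `∀` demand derivability outright; for `∧`, `∨`, `∃` the
right rules recover it. -/
theorem Slash.lj {A : Formula L 0} (h : Slash A) : LJ A := by
  induction A using inst_induction with
  | top => exact .topAx
  | bot => simp [Slash] at h
  | prop R => simpa [Slash] using h
  | pred P t => simpa [Slash] using h
  | neg A _ => rw [Slash] at h; exact h.1
  | and A B ihA ihB => rw [Slash] at h; exact .andR (ihA h.1) (ihB h.2)
  | or A B ihA ihB => rw [Slash] at h; exact h.elim (fun h => .orR₁ (ihA h)) fun h => .orR₂ (ihB h)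
  | imp A B _ _ => rw [Slash] at h; exact h.1
  | all F _ => rw [Slash] at h; exact h.1
  | ex F ih =>
    rw [Slash] at h
    obtain ⟨a, ha⟩ := h
    exact .exR a (ih a ha)

/-- Derivations of `LJ` preserve the slash under every renaming of free variables. -/
theorem Deriv.slash {Γ : List (Formula L 0)} {Λ : Option (Formula L 0)} (d : Deriv ∅ Γ Λ)
    (e : ℕ → ℕ) (h : ∀ G ∈ Γ, Slash (G.rename e)) : ∃ G ∈ Λ, Slash (G.rename e) := by
  -- Slashed hypotheses are derivable and can be cut away. This supplies the derivability conjunct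
  -- of the slash for `¬`, `⊃` and `∀`.
  have provable {Γ : List (Formula L 0)} {A : Formula L 0} (d : Deriv ∅ Γ (some A)) (e : ℕ → ℕ)
      (h : ∀ G ∈ Γ, Slash (G.rename e)) : LJ (A.rename e) :=
    (d.rename e).cut_all (by simpa using fun G hG => (h G hG).lj)
  induction d generalizing e with
  | ax A => simpa using h
  | topAx => simp [Formula.rename, Slash]
  | botAx => simp [Formula.rename, Slash] at h
  | thinL A _ ih => exact ih e (List.forall_mem_cons.1 h).2
  | thinR A _ ih => simpa using ih e h
  | contr _ ih => exact ih e (by simpa using h)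
  | exch _ ih => exact ih e (by simp at h ⊢; grind)
  | cut _ _ ih₁ ih₂ =>
    have h := List.forall_mem_append.1 h
    exact ih₂ e (List.forall_mem_cons.2 ⟨by simpa using ih₁ e h.1, h.2⟩)
  | andR _ _ ih₁ ih₂ =>
    simpa [Formula.rename, Slash] using And.intro (ih₁ e h) (ih₂ e h)
  | andL₁ _ ih =>
    simp only [List.forall_mem_cons, Formula.rename, Slash] at h
    exact ih e (List.forall_mem_cons.2 ⟨h.1.1, h.2⟩)
  | andL₂ _ ih =>
    simp only [List.forall_mem_cons, Formula.rename, Slash] at h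
    exact ih e (List.forall_mem_cons.2 ⟨h.1.2, h.2⟩)
  | orL _ _ ih₁ ih₂ =>
    simp only [List.forall_mem_cons, Formula.rename, Slash] at h
    exact h.1.elim (fun h' => ih₁ e (List.forall_mem_cons.2 ⟨h', h.2⟩))
      fun h' => ih₂ e (List.forall_mem_cons.2 ⟨h', h.2⟩)
  | orR₁ _ ih => simpa [Formula.rename, Slash] using Or.inl (by simpa using ih e h)
  | orR₂ _ ih => simpa [Formula.rename, Slash] using Or.inr (by simpa using ih e h)
  | negR d ih =>
    refine ⟨_, rfl, ?_⟩
    rw [Formula.rename, Slash]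
    exact ⟨provable (.negR d) e h, fun hA => by
      simpa using ih e (List.forall_mem_cons.2 ⟨hA, h⟩)⟩
  | negL _ ih =>
    simp only [List.forall_mem_cons, Formula.rename, Slash] at h
    exact absurd (by simpa using ih e h.2) h.1.2
  | impR d ih =>
    refine ⟨_, rfl, ?_⟩
    rw [Formula.rename, Slash]
    exact ⟨provable (.impR d) e h, fun hA => by
      simpa using ih e (List.forall_mem_cons.2 ⟨hA, h⟩)⟩
  | impL _ _ ih₁ ih₂ =>
    simp only [List.forall_mem_cons, List.forall_mem_append, Formula.rename, Slash] at h
    exact ih₂ e (List.forall_mem_cons.2 ⟨h.1.2 (by simpa using ih₁ e h.2.1), h.2.2⟩)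
  | @allR F Γ a hΓ hF d ih =>
    refine ⟨_, rfl, ?_⟩
    rw [Formula.rename, Slash]
    refine ⟨provable (.allR a hΓ hF d) e h, fun b => ?_⟩
    -- All instances come from the one premise by varying the renaming at `a`, which does not occur
    -- in `Γ`; this is why the induction is over all `e`.
    rw [← rename_update_inst b hF]
    simpa using ih (Function.update e a b) fun G hG => by
      rw [rename_update b (hΓ G hG)]; exact h G hG
  | @allL F Γ Λ a _ ih =>
    simp only [List.forall_mem_cons, Formula.rename, Slash] at h
    exact ih e (List.forall_mem_cons.2 ⟨rename_inst e a F ▸ h.1.2 (e a), h.2⟩)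
  | @exR F Γ a _ ih =>
    obtain ⟨G, hG, hS⟩ := ih e h
    obtain rfl : F.inst a = G := by simpa using hG
    refine ⟨_, rfl, ?_⟩
    rw [Formula.rename, Slash]
    exact ⟨e a, rename_inst e a F ▸ hS⟩
  | @exL F Γ Λ a hΓ hΛ hF _ ih =>
    simp only [List.forall_mem_cons, Formula.rename, Slash] at h
    obtain ⟨⟨b, hb⟩, h⟩ := h
    rw [← rename_update_inst b hF] at hb
    obtain ⟨G, hG, hS⟩ := ih (Function.update e a b) (List.forall_mem_cons.2 ⟨hb, fun G hG => by
      rw [rename_update b (hΓ G hG)]; exact h G hG⟩)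
    exact ⟨G, hG, rename_update b (hΛ G hG) ▸ hS⟩
  | neutral hN => exact hN.elim

theorem LJ.slash {A : Formula L 0} (h : LJ A) : Slash A := by
  simpa using Deriv.slash h id (by simp)

/-! ### Disjunction and existence properties; classical formulas not derivable in LJ⁺ -/

/-- The disjunction property of `LJ⁺` for unipolar formulas. -/
theorem LJPlus.or_elim {A B : Formula L 0} (hAB : (A.or B).IsUnipolar) (h : LJPlus (A.or B)) :
    LJPlus A ∨ LJPlus B := by
  have := (h.lj hAB).slash
  rw [Slash] at this
  exact this.imp (fun h => h.lj.ljPlus) fun h => h.lj.ljPlus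

/-- The existence property of `LJ⁺` for unipolar formulas. -/
theorem LJPlus.exists_inst {A : Formula L 1} (hA : A.ex.IsUnipolar) (h : LJPlus A.ex) :
    ∃ a, LJPlus (A.inst a) := by
  have := (h.lj hA).slash
  rw [Slash] at this
  exact this.imp fun a h => h.lj.ljPlus

theorem LJPlus.holds {A : Formula L 0} (h : LJPlus A) (v : ∀ k, L.Relations k → Prop) :
    A.Holds v := by
  simpa using Deriv.holds v h (by simp)

/-- Both disjuncts are introduced in separate copies of the formula, which right contraction merges.
-/
theorem lk_em (A : Formula L 0) : LK (A.or A.neg) :=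
  .contrR (Θ := []) (.orR₁ (Θ := [A.or A.neg]) (.exchR (Θ := []) (Λ := [])
    (.orR₂ (Θ := [A]) (.negR (Θ := [A]) (.ax A)))))

/-- By the disjunction property `A` or `¬A` would be derivable, hence true in every one-element
structure; `v` refutes the first and `w` the second. -/
theorem not_ljPlus_em {A : Formula L 0} (hA : (A.or A.neg).IsUnipolar)
    {v w : ∀ k, L.Relations k → Prop} (hv : ¬ A.Holds v) (hw : A.Holds w) :
    ¬ LJPlus (A.or A.neg) := fun h =>
  (h.or_elim hA).elim (fun h => hv (h.holds v)) fun h => h.holds w hw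

theorem lk_lemExOr (P : L.Relations 1) (R : L.Relations 0) : LK (lemExOr P R) :=
  .orR₁ (Θ := []) (lk_em _)

theorem not_ljPlus_lemExOr (P : L.Relations 1) (R : L.Relations 0) :
    ¬ LJPlus (lemExOr P R) := by
  intro h
  -- The only propositional occurrence is the positive `R`, so the disjunction property applies
  -- twice; `R` itself fails when all symbols are false.
  rcases h.or_elim (fun S => .inl (by simp [exPred, Occurs])) with h | h
  · exact not_ljPlus_em (v := fun _ _ => False) (w := fun _ _ => True)
      (fun S => .inl (by simp [exPred, Occurs])) (by simp [exPred, Holds])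
      (by simp [exPred, Holds]) h
  · exact h.holds fun _ _ => False

end DecAtoms

theorem mainTheorem3 (L : FirstOrder.Language.{u, v}) [L.IsRelational] :
    -- LJ⁺ and LJ derive the same unipolar formulas
    (∀ F : DecAtoms.Formula L 0, F.IsUnipolar → (DecAtoms.LJPlus F ↔ DecAtoms.LJ F)) ∧
    -- the disjunction property of LJ⁺ for unipolar formulas
    (∀ A B : DecAtoms.Formula L 0, (A.or B).IsUnipolar → DecAtoms.LJPlus (A.or B) →
      DecAtoms.LJPlus A ∨ DecAtoms.LJPlus B) ∧
    -- the existence property of LJ⁺ for unipolar formulas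
    (∀ A : DecAtoms.Formula L 1, A.ex.IsUnipolar → DecAtoms.LJPlus A.ex →
      ∃ a : ℕ, DecAtoms.LJPlus (A.inst a)) ∧
    -- `(∃x P(x) ∨ ¬∃x P(x)) ∨ R` is derivable in LK but not in LJ⁺
    (∀ (P : L.Relations 1) (R : L.Relations 0),
      DecAtoms.LK (DecAtoms.lemExOr P R) ∧ ¬ DecAtoms.LJPlus (DecAtoms.lemExOr P R)) ∧
    -- as soon as there is a predicate symbol, LK derives formulas that LJ⁺ does not
    ((∃ k : ℕ, Nonempty (L.Relations (k + 1))) →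
      ∃ F : DecAtoms.Formula L 0, DecAtoms.LK F ∧ ¬ DecAtoms.LJPlus F) := by
  refine ⟨fun F hF => ⟨fun h => h.lj hF, fun h => h.ljPlus⟩, fun A B hAB h => h.or_elim hAB,
    fun A hA h => h.exists_inst hA,
    fun P R => ⟨DecAtoms.lk_lemExOr P R, DecAtoms.not_ljPlus_lemExOr P R⟩, ?_⟩
  rintro ⟨k, ⟨P⟩⟩
  -- Excluded middle for an atom of positive arity has no propositional symbols, so it is trivially
  -- unipolar.
  refine ⟨_, DecAtoms.lk_em (.pred P fun _ => Sum.inl 0), ?_⟩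
  exact DecAtoms.not_ljPlus_em (v := fun _ _ => False) (w := fun _ _ => True)
    (fun S => .inl (by simp [DecAtoms.Formula.Occurs])) (by simp [DecAtoms.Formula.Holds])
    (by simp [DecAtoms.Formula.Holds])
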